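/- Let $\alpha>0$ and let $F^2_\alpha$ be the Fock space, i.e. the space of all entire functions $f$ with $$\|f\|^2=\frac{\alpha}{\pi}\int_{\mathbb C}|f(z)|^2e^{-\alpha|z|^2}\,dA(z)<\infty ,$$ where $dA$ is area measure, with the corresponding inner product. For a bounded linear operator $A$ on a complex Hilbert space $H$, let $\mathrm{Ext}(A)$ be the set of all $\lambda\in\mathbb C$ for which there is a nonzero bounded linear operator $X$ on $H$ with $AX=\lambda XA$. Let $w,b\in\mathbb C$ with $0<|w|\le 1$, and assume $b=0$ if $|w|=1$; put $\varphi(z)=wz+b$. Then the composition operator $C_\varphi f=f\circ\varphi$ is a bounded linear operator on $F^2_\alpha$, and $$\mathrm{Ext}(C_\varphi)=\{w^n:n\in\mathbb Z\}.$$ -/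

import Mathlib

open MeasureTheory

noncomputable section

/-- The Gaussian measure `(α / π) e^{-α |z|²} dA(z)` on the complex plane, where `dA` is area. -/
def gaussianAreaMeasure (α : ℝ) : Measure ℂ :=
  (volume : Measure ℂ).withDensity
    (fun z => ENNReal.ofReal (α / Real.pi * Real.exp (-α * ‖z‖ ^ 2)))

/-- The entire functions that are square integrable for the Gaussian measure, as a subspace of
all functions on the plane. -/
def fockSubmodule (α : ℝ) : Submodule ℂ (ℂ → ℂ) where
  carrier := {f | Differentiable ℂ f ∧ MemLp f 2 (gaussianAreaMeasure α)}
  add_mem' hf hg := ⟨hf.1.add hg.1, hf.2.add hg.2⟩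
  zero_mem' := ⟨differentiable_const 0, MemLp.zero⟩
  smul_mem' c _ hf := ⟨hf.1.const_smul c, hf.2.const_smul c⟩

/-- The Fock space `F²_α`. It is a type of its own, so that its topology is the one of the norm
defined below and not the topology of pointwise convergence. -/
def Fock (α : ℝ) : Type := ↥(fockSubmodule α)

namespace Fock

variable {α : ℝ}

instance : AddCommGroup (Fock α) := inferInstanceAs (AddCommGroup ↥(fockSubmodule α))

instance : Module ℂ (Fock α) := inferInstanceAs (Module ℂ ↥(fockSubmodule α))

instance : CoeFun (Fock α) (fun _ => ℂ → ℂ) := ⟨fun f => f.1⟩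

theorem differentiable (f : Fock α) : Differentiable ℂ (f : ℂ → ℂ) := f.2.1

theorem memLp (f : Fock α) : MemLp (f : ℂ → ℂ) 2 (gaussianAreaMeasure α) := f.2.2

theorem ext {f g : Fock α} (h : ∀ z, f z = g z) : f = g := Subtype.ext (funext h)

@[simp] theorem add_apply (f g : Fock α) (z : ℂ) : (f + g) z = f z + g z := rfl

@[simp] theorem smul_apply (c : ℂ) (f : Fock α) (z : ℂ) : (c • f) z = c * f z := rfl

@[simp] theorem zero_apply (z : ℂ) : (0 : Fock α) z = 0 := rfl

/-- The inner product `⟨f, g⟩ = ∫ conj f · g`, conjugate-linear in the first variable. -/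
instance : Inner ℂ (Fock α) :=
  ⟨fun f g => ∫ z, (starRingEnd ℂ) (f z) * g z ∂(gaussianAreaMeasure α)⟩

theorem inner_def (f g : Fock α) :
    inner ℂ f g = ∫ z, (starRingEnd ℂ) (f z) * g z ∂(gaussianAreaMeasure α) := rfl

theorem integrable_inner (f g : Fock α) :
    Integrable (fun z => (starRingEnd ℂ) (f z) * g z) (gaussianAreaMeasure α) :=
  MemLp.integrable_mul (p := 2) (q := 2) f.memLp.star g.memLp

theorem inner_self_eq (f : Fock α) :
    inner ℂ f f = ((∫ z, ‖f z‖ ^ 2 ∂(gaussianAreaMeasure α) : ℝ) : ℂ) := by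
  rw [inner_def, ← integral_complex_ofReal]
  congr 1
  funext z
  rw [mul_comm, Complex.mul_conj, Complex.normSq_eq_norm_sq]

theorem eq_zero_of_inner_self [hα : Fact (0 < α)] (f : Fock α) (h : inner ℂ f f = 0) :
    f = 0 := by
  rw [inner_self_eq, Complex.ofReal_eq_zero,
    integral_eq_zero_iff_of_nonneg (fun z => by positivity) f.memLp.norm.integrable_sq] at h
  have hac : (volume : Measure ℂ) ≪ gaussianAreaMeasure α := by
    refine withDensity_absolutelyContinuous' (by fun_prop) (Filter.Eventually.of_forall ?_)
    intro z
    have hpos := hα.out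
    have : 0 < α / Real.pi * Real.exp (-α * ‖z‖ ^ 2) := by positivity
    simpa using this
  have h2 : (f : ℂ → ℂ) =ᵐ[volume] (fun _ => (0 : ℂ)) := by
    filter_upwards [hac.ae_le h] with z hz
    simpa using hz
  exact ext fun z => congrFun
    (Measure.eq_of_ae_eq h2 f.differentiable.continuous continuous_const) z

@[reducible] def innerCore [Fact (0 < α)] : InnerProductSpace.Core ℂ (Fock α) where
  conj_inner_symm f g := by
    rw [inner_def, inner_def, ← integral_conj]
    congr 1
    funext z
    simp [mul_comm]
  re_inner_nonneg f := by
    rw [inner_self_eq]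
    exact integral_nonneg (fun z => by positivity)
  add_left f g h := by
    rw [inner_def, inner_def, inner_def,
      ← integral_add (integrable_inner f h) (integrable_inner g h)]
    congr 1
    funext z
    simp [add_mul]
  smul_left f g c := by
    rw [inner_def, inner_def, ← integral_const_mul]
    congr 1
    funext z
    simp [mul_assoc]
  definite := eq_zero_of_inner_self

instance [Fact (0 < α)] : NormedAddCommGroup (Fock α) := innerCore.toNormedAddCommGroup

instance [Fact (0 < α)] : InnerProductSpace ℂ (Fock α) :=
  InnerProductSpace.ofCore innerCore.toCore

theorem norm_sq_eq [Fact (0 < α)] (f : Fock α) :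
    ‖f‖ ^ 2 = ∫ z, ‖f z‖ ^ 2 ∂(gaussianAreaMeasure α) := by
  have h : inner ℂ f f = ((‖f‖ : ℂ)) ^ 2 := inner_self_eq_norm_sq_to_K f
  have h2 : inner ℂ f f = ((∫ z, ‖f z‖ ^ 2 ∂(gaussianAreaMeasure α) : ℝ) : ℂ) := inner_self_eq f
  rw [h2] at h
  exact_mod_cast h.symm

end Fock

/-- The bounded operator `C` on the Fock space is the composition operator `f ↦ f ∘ φ`. -/
def IsCompositionOperator {α : ℝ} [Fact (0 < α)] (φ : ℂ → ℂ) (C : Fock α →L[ℂ] Fock α) : Prop :=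
  ∀ (f : Fock α) (z : ℂ), (C f) z = f (φ z)

/-- `Ext(A)`: the complex numbers `μ` such that `A X = μ X A` for some nonzero bounded
operator `X`. -/
def extendedSpectrum {H : Type*} [NormedAddCommGroup H] [InnerProductSpace ℂ H]
    (A : H →L[ℂ] H) : Set ℂ :=
  {μ | ∃ X : H →L[ℂ] H, X ≠ 0 ∧ A ∘L X = μ • (X ∘L A)}

end

/-!
The map `φ z = w z + b` has a fixed point `p`, and the functions `(z - p) ^ n` are eigenvectors of
`C_φ` with eigenvalues `w ^ n`. Every eigenvalue has this form: if `f ∘ φ = μ f` with `f ≠ 0`, then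
a nonzero Taylor coefficient of `f` at `p` of order `k` forces `μ = w ^ k`
(`Fock.eigenvalue_eq_pow`).

If `C X = μ X C` with `X ≠ 0`, then `X` is nonzero on some `(z - p) ^ n` because polynomials are
dense, and `X (z - p) ^ n` is then an eigenvector of `C` with eigenvalue `μ w ^ n`; hence
`μ w ^ n = w ^ k`. Conversely the functional `ℓ f = f^(j)(p)` satisfies `ℓ ∘ C = w ^ j ℓ`, and the
rank-one operator `f ↦ ℓ f • (z - p) ^ k` intertwines with `μ = w ^ (k - j)`.

The analytic facts behind this are:
* boundedness of `C_φ` (`Fock.exists_isCompositionOperator`), from a pointwise comparison of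
  Gaussian weights and a linear change of variables;
* `⟨z ^ n, f⟩ = a_n ‖z ^ n‖²` for the Taylor coefficients `a_n` of `f` at the origin
  (`Fock.inner_monomial`), which also makes the derivatives at a point bounded functionals
  (`Fock.exists_coeff_functional`);
* norm convergence of the Taylor polynomials (`Fock.tendsto_taylorSum`), by orthogonality and
  Fatou's lemma.
-/

/-! ### Cauchy's formula on the unit circle -/

open Complex in
/-- The Fourier coefficients of `g` on the unit circle are its Taylor coefficients at the origin. -/
theorem integral_circle_conj_pow_mul {g : ℂ → ℂ} (hg : Differentiable ℂ g) (n : ℕ) :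
    ∫ θ in (0 : ℝ)..2 * Real.pi,
        (starRingEnd ℂ) (exp (θ * I)) ^ n * g (exp (θ * I)) =
      2 * Real.pi * (iteratedDeriv n g 0 / n.factorial) := by
  have h := hg.differentiableOn (s := Metric.closedBall 0 1)
    |>.circleIntegral_one_div_sub_center_pow_smul one_pos n
  rw [circleIntegral] at h
  have hI : ∀ θ : ℝ, deriv (circleMap 0 1) θ •
      ((1 : ℂ) / (circleMap 0 1 θ - 0) ^ (n + 1)) • g (circleMap 0 1 θ) =
      I * ((starRingEnd ℂ) (exp (θ * I)) ^ n * g (exp (θ * I))) := by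
    intro θ
    have h1 : (starRingEnd ℂ) (exp (θ * I)) = (exp (θ * I))⁻¹ := by
      rw [← exp_conj, ← exp_neg]; simp
    have h2 := exp_ne_zero (θ * I)
    rw [h1, deriv_circleMap, inv_pow]
    simp only [circleMap, ofReal_one, one_mul, zero_add, sub_zero, smul_eq_mul]
    field_simp
    ring
  simp_rw [hI] at h
  rw [intervalIntegral.integral_const_mul] at h
  apply mul_left_cancel₀ I_ne_zero
  rw [h, smul_eq_mul]
  ring

/-! ### The Gaussian measure under affine maps -/

theorem norm_mul_add_sq_le (w b : ℂ) (hw : ‖w‖ ≤ 1) (hb : ‖w‖ = 1 → b = 0) :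
    ∃ K : ℝ, ∀ z : ℂ, ‖w * z + b‖ ^ 2 ≤ ‖z‖ ^ 2 + K := by
  rcases hw.eq_or_lt with h | h
  · refine ⟨0, fun z => ?_⟩
    simp [hb h, h]
  · have hd : 0 < 1 - ‖w‖ := sub_pos.mpr h
    refine ⟨‖b‖ ^ 2 / (1 - ‖w‖), fun z => ?_⟩
    have h1 : ‖w * z + b‖ ≤ ‖w‖ * ‖z‖ + ‖b‖ := (norm_add_le _ _).trans (by rw [norm_mul])
    -- Jensen's inequality for the square, with weights `‖w‖` and `1 - ‖w‖`
    have h2 : (‖w‖ * ‖z‖ + ‖b‖) ^ 2 ≤ ‖w‖ * ‖z‖ ^ 2 + ‖b‖ ^ 2 / (1 - ‖w‖) := by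
      have h3 : ‖w‖ * ‖z‖ ^ 2 + ‖b‖ ^ 2 / (1 - ‖w‖) - (‖w‖ * ‖z‖ + ‖b‖) ^ 2 =
          ‖w‖ * ((1 - ‖w‖) * ‖z‖ - ‖b‖) ^ 2 / (1 - ‖w‖) := by
        field_simp
        ring
      have : 0 ≤ ‖w‖ * ((1 - ‖w‖) * ‖z‖ - ‖b‖) ^ 2 / (1 - ‖w‖) := by positivity
      linarith
    have h4 : ‖w‖ * ‖z‖ ^ 2 ≤ ‖z‖ ^ 2 := mul_le_of_le_one_left (by positivity) hw
    have h5 : ‖w * z + b‖ ^ 2 ≤ (‖w‖ * ‖z‖ + ‖b‖) ^ 2 := by gcongr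
    linarith

theorem exists_map_mul_add_volume (w b : ℂ) (hw0 : w ≠ 0) :
    ∃ c : ENNReal, c ≠ ⊤ ∧
      Measure.map (fun z => w * z + b) (volume : Measure ℂ) = c • volume := by
  have hdet : LinearMap.det (LinearMap.mulLeft ℝ w) ≠ 0 :=
    ((hw0.isUnit.map (Algebra.lmul ℝ ℂ)).map LinearMap.det).ne_zero
  have h := Measure.map_linearMap_addHaar_eq_smul_addHaar (volume : Measure ℂ) hdet
  refine ⟨ENNReal.ofReal |(LinearMap.det (LinearMap.mulLeft ℝ w))⁻¹|, ENNReal.ofReal_ne_top, ?_⟩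
  have hcomp : (fun z => w * z + b) = (fun z => z + b) ∘ (LinearMap.mulLeft ℝ w) := rfl
  have hmeas : Measurable (LinearMap.mulLeft ℝ w) := measurable_const_mul w
  rw [hcomp, ← Measure.map_map (by fun_prop) hmeas, h, Measure.map_smul, map_add_right_eq_self]

/-- The substitution `u = w z + b` carries the Gaussian measure to one dominated by a multiple of
it, because `exp (-α |z|²) ≤ exp (α K) exp (-α |w z + b|²)` for a constant `K`. -/
theorem exists_map_mul_add_gaussian_le (α : ℝ) (hα : 0 < α) (w b : ℂ) (hw0 : w ≠ 0) (hw : ‖w‖ ≤ 1)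
    (hb : ‖w‖ = 1 → b = 0) :
    ∃ c : ENNReal, c ≠ ⊤ ∧
      Measure.map (fun z => w * z + b) (gaussianAreaMeasure α) ≤ c • gaussianAreaMeasure α := by
  obtain ⟨K, hK⟩ := norm_mul_add_sq_le w b hw hb
  obtain ⟨c, hc, hmap⟩ := exists_map_mul_add_volume w b hw0
  refine ⟨ENNReal.ofReal (Real.exp (α * K)) * c, ENNReal.mul_ne_top ENNReal.ofReal_ne_top hc, ?_⟩
  have hφ : Measurable (fun z => w * z + b) := by fun_prop
  rw [Measure.le_iff]
  intro s hs
  rw [Measure.map_apply hφ hs, Measure.smul_apply, gaussianAreaMeasure,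
    withDensity_apply _ (hφ hs), withDensity_apply _ hs, smul_eq_mul, mul_assoc]
  calc ∫⁻ z in (fun z => w * z + b) ⁻¹' s,
        ENNReal.ofReal (α / Real.pi * Real.exp (-α * ‖z‖ ^ 2))
      ≤ ∫⁻ z in (fun z => w * z + b) ⁻¹' s, ENNReal.ofReal (Real.exp (α * K)) *
        ENNReal.ofReal (α / Real.pi * Real.exp (-α * ‖w * z + b‖ ^ 2)) := by
        refine lintegral_mono fun z => ?_
        rw [← ENNReal.ofReal_mul (by positivity)]
        refine ENNReal.ofReal_le_ofReal ?_
        rw [mul_left_comm, ← Real.exp_add]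
        gcongr
        nlinarith [hK z]
    _ = ENNReal.ofReal (Real.exp (α * K)) * ∫⁻ z in (fun z => w * z + b) ⁻¹' s,
        ENNReal.ofReal (α / Real.pi * Real.exp (-α * ‖w * z + b‖ ^ 2)) :=
        lintegral_const_mul _ (by fun_prop)
    _ = ENNReal.ofReal (Real.exp (α * K)) * (c * ∫⁻ z in s,
        ENNReal.ofReal (α / Real.pi * Real.exp (-α * ‖z‖ ^ 2))) := by
        rw [← smul_eq_mul (a := c), ← lintegral_smul_measure, ← Measure.restrict_smul, ← hmap,
          setLIntegral_map hs (by fun_prop) hφ]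

theorem measurePreserving_mul_gaussian (α : ℝ) {u : ℂ} (hu : ‖u‖ = 1) :
    MeasurePreserving (fun z => u * z) (gaussianAreaMeasure α) (gaussianAreaMeasure α) := by
  have h : MeasurePreserving (fun z : ℂ => u * z) volume volume :=
    (rotation ⟨u, mem_sphere_zero_iff_norm.mpr hu⟩).measurePreserving
  refine ⟨h.measurable, Measure.ext fun s hs => ?_⟩
  rw [Measure.map_apply h.measurable hs, gaussianAreaMeasure,
    withDensity_apply _ (h.measurable hs), withDensity_apply _ hs,
    ← h.setLIntegral_comp_preimage hs (by fun_prop)]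
  simp [hu]

theorem integrable_norm_pow_gaussian (α : ℝ) (hα : 0 < α) (n : ℕ) :
    Integrable (fun z : ℂ => ‖z‖ ^ n) (gaussianAreaMeasure α) := by
  rw [gaussianAreaMeasure, integrable_withDensity_iff (by fun_prop)
    (Filter.Eventually.of_forall fun z => ENNReal.ofReal_lt_top)]
  have h : Integrable (fun z : ℂ => ‖z‖ ^ (n : ℝ) * Real.exp (-α * ‖z‖ ^ (2 : ℝ))) := by
    -- a nonzero value of the Bochner integral certifies integrability
    by_contra hn
    have h1 := Complex.integral_rpow_mul_exp_neg_mul_rpow (p := 2) (q := n) one_le_two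
      (by linarith [n.cast_nonneg (α := ℝ)]) hα
    rw [integral_undef hn] at h1
    have : 0 < Real.Gamma (((n : ℝ) + 2) / 2) := Real.Gamma_pos_of_pos (by positivity)
    have : 0 < (2 * Real.pi / 2) * α ^ (-((n : ℝ) + 2) / 2) * Real.Gamma (((n : ℝ) + 2) / 2) := by
      positivity
    linarith
  refine (h.const_mul (α / Real.pi)).congr (Filter.Eventually.of_forall fun z => ?_)
  simp only
  rw [ENNReal.toReal_ofReal (by positivity), Real.rpow_natCast, Real.rpow_two]
  ring

namespace Fock

variable {α : ℝ}

/-! ### Composition with affine contractions -/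

theorem sum_apply {ι : Type*} (s : Finset ι) (f : ι → Fock α) (z : ℂ) :
    (∑ i ∈ s, f i) z = ∑ i ∈ s, f i z := by
  classical
  induction s using Finset.induction_on with
  | empty => simp
  | insert i s hi ih => rw [Finset.sum_insert hi, Finset.sum_insert hi, add_apply, ih]

theorem eLpNorm_eq [Fact (0 < α)] (f : Fock α) :
    eLpNorm (f : ℂ → ℂ) 2 (gaussianAreaMeasure α) = ENNReal.ofReal ‖f‖ := by
  rw [f.memLp.eLpNorm_eq_integral_rpow_norm two_ne_zero ENNReal.ofNat_ne_top]
  congr 1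
  simp only [ENNReal.toReal_ofNat, Real.rpow_two]
  rw [← norm_sq_eq, ← one_div, ← Real.sqrt_eq_rpow, Real.sqrt_sq (norm_nonneg f)]

theorem exists_isCompositionOperator [hα : Fact (0 < α)] (w b : ℂ) (hw0 : w ≠ 0) (hw : ‖w‖ ≤ 1)
    (hb : ‖w‖ = 1 → b = 0) :
    ∃ C : Fock α →L[ℂ] Fock α, IsCompositionOperator (fun z => w * z + b) C := by
  obtain ⟨c, hc, hle⟩ := exists_map_mul_add_gaussian_le α hα.out w b hw0 hw hb
  have hφ : AEMeasurable (fun z => w * z + b) (gaussianAreaMeasure α) := by fun_prop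
  have hmap (f : Fock α) : MemLp (f : ℂ → ℂ) 2
      (Measure.map (fun z => w * z + b) (gaussianAreaMeasure α)) :=
    f.memLp.of_measure_le_smul hc hle
  have hmem (f : Fock α) : (fun z => f (w * z + b)) ∈ fockSubmodule α :=
    ⟨f.differentiable.comp (by fun_prop), (hmap f).comp_of_map hφ⟩
  let T : Fock α →ₗ[ℂ] Fock α :=
    { toFun := fun f => ⟨fun z => f (w * z + b), hmem f⟩
      map_add' := fun f g => rfl
      map_smul' := fun r f => rfl }
  refine ⟨T.mkContinuous (c ^ (1 / 2 : ℝ)).toReal fun f => ?_, fun f z => rfl⟩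
  have hct : c ^ (1 / 2 : ℝ) ≠ ⊤ := ENNReal.rpow_ne_top_of_nonneg (by norm_num) hc
  have h : eLpNorm (T f : ℂ → ℂ) 2 (gaussianAreaMeasure α) ≤
      c ^ (1 / 2 : ℝ) * eLpNorm (f : ℂ → ℂ) 2 (gaussianAreaMeasure α) :=
    calc eLpNorm (T f : ℂ → ℂ) 2 (gaussianAreaMeasure α)
        = eLpNorm (f : ℂ → ℂ) 2 (Measure.map (fun z => w * z + b) (gaussianAreaMeasure α)) :=
          (eLpNorm_map_measure (hmap f).1 hφ).symm
      _ ≤ eLpNorm (f : ℂ → ℂ) 2 (c • gaussianAreaMeasure α) := eLpNorm_mono_measure _ hle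
      _ = c ^ (1 / 2 : ℝ) * eLpNorm (f : ℂ → ℂ) 2 (gaussianAreaMeasure α) := by
          rw [eLpNorm_smul_measure_of_ne_top ENNReal.ofNat_ne_top]
          simp
  rw [eLpNorm_eq, eLpNorm_eq] at h
  have h2 := ENNReal.toReal_mono (ENNReal.mul_ne_top hct ENNReal.ofReal_ne_top) h
  rwa [ENNReal.toReal_mul, ENNReal.toReal_ofReal (norm_nonneg _),
    ENNReal.toReal_ofReal (norm_nonneg _)] at h2

/-! ### Monomials and Taylor coefficients -/

/-- The monomial `z ^ n` as an element of the Fock space. -/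
noncomputable def monomial (α : ℝ) [hα : Fact (0 < α)] (n : ℕ) : Fock α :=
  ⟨fun z => z ^ n, by fun_prop, by
    rw [memLp_two_iff_integrable_sq_norm (by fun_prop)]
    refine (integrable_norm_pow_gaussian α hα.out (n * 2)).congr
      (Filter.Eventually.of_forall fun z => ?_)
    simp [pow_mul]⟩

variable [hα : Fact (0 < α)]

theorem monomial_apply (n : ℕ) (z : ℂ) : monomial α n z = z ^ n := rfl

theorem monomial_ne_zero (n : ℕ) : monomial α n ≠ 0 := by
  intro h
  have h1 : monomial α n 1 = 0 := by rw [h]; rfl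
  simp [monomial_apply] at h1

/-- The `n`-th Taylor coefficient at the origin. -/
noncomputable def coeff (f : ℂ → ℂ) (n : ℕ) : ℂ := iteratedDeriv n f 0 / n.factorial

theorem hasSum_coeff {f : ℂ → ℂ} (hf : Differentiable ℂ f) (z : ℂ) :
    HasSum (fun n => coeff f n * z ^ n) (f z) := by
  convert! Complex.hasSum_taylorSeries_of_entire hf 0 z using 2 with n
  rw [coeff, sub_zero, smul_eq_mul, smul_eq_mul]
  ring

theorem coeff_comp_mul {f : ℂ → ℂ} (hf : Differentiable ℂ f) (c : ℂ) (n : ℕ) :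
    coeff (fun z => f (c * z)) n = c ^ n * coeff f n := by
  simp only [coeff]
  rw [iteratedDeriv_comp_const_mul hf.contDiff]
  simp [mul_div_assoc]

theorem coeff_const_mul (f : ℂ → ℂ) (c : ℂ) (n : ℕ) :
    coeff (fun z => c * f z) n = c * coeff f n := by
  simp only [coeff]
  rw [iteratedDeriv_const_mul_field, mul_div_assoc]

theorem coeff_pow (m n : ℕ) : coeff (fun z => z ^ m) n = if n = m then 1 else 0 := by
  simp only [coeff]
  rw [iteratedDeriv_fun_pow_zero]
  split_ifs with h
  · subst h
    exact div_self (by exact_mod_cast n.factorial_ne_zero)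
  · simp

theorem exists_coeff_ne_zero {f : ℂ → ℂ} (hf : Differentiable ℂ f) {z : ℂ} (hz : f z ≠ 0) :
    ∃ n, coeff f n ≠ 0 := by
  by_contra! h
  have h1 := hasSum_coeff hf z
  simp only [h, zero_mul] at h1
  exact hz (h1.unique hasSum_zero)

/-- The inner product with `z ^ n` extracts the `n`-th Taylor coefficient. Since the Gaussian
measure is rotation invariant, the integrand may be replaced by its average over rotations, which
Cauchy's formula evaluates. -/
theorem inner_monomial (f : Fock α) (n : ℕ) :
    inner ℂ (monomial α n) f = coeff f n * (‖monomial α n‖ ^ 2 : ℝ) := by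
  let μ := gaussianAreaMeasure α
  have : SFinite μ := inferInstanceAs (SFinite (volume.withDensity _))
  have : IsFiniteMeasure (volume.restrict (Set.uIoc 0 (2 * Real.pi))) := by
    rw [Set.uIoc_of_le Real.two_pi_pos.le]
    infer_instance
  set F : ℂ → ℂ := fun z => (starRingEnd ℂ) (z ^ n) * f z with hF
  have hFi : Integrable F μ := integrable_inner (monomial α n) f
  have hFc : Continuous F := by
    have := f.differentiable.continuous
    fun_prop
  have hu (θ : ℝ) : ‖Complex.exp (θ * Complex.I)‖ = 1 := Complex.norm_exp_ofReal_mul_I θ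
  have hrot (θ : ℝ) := measurePreserving_mul_gaussian α (hu θ)
  have hemb (θ : ℝ) : MeasurableEmbedding (fun z : ℂ => Complex.exp (θ * Complex.I) * z) :=
    measurableEmbedding_mulLeft₀ (Complex.exp_ne_zero _)
  have hint (θ : ℝ) : ∫ z, F (Complex.exp (θ * Complex.I) * z) ∂μ = ∫ z, F z ∂μ :=
    (hrot θ).integral_comp (hemb θ) F
  have hinner (z : ℂ) :
      ∫ θ in (0 : ℝ)..2 * Real.pi, F (Complex.exp (θ * Complex.I) * z) =
        2 * Real.pi * (coeff f n * (‖z ^ n‖ ^ 2 : ℝ)) := by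
    have h := integral_circle_conj_pow_mul
      (g := fun u => f (z * u)) (f.differentiable.comp (by fun_prop)) n
    have h2 := coeff_comp_mul f.differentiable z n
    rw [coeff] at h2
    rw [h2] at h
    have h3 (θ : ℝ) : F (Complex.exp (θ * Complex.I) * z) = (starRingEnd ℂ) (z ^ n) *
        ((starRingEnd ℂ) (Complex.exp (θ * Complex.I)) ^ n *
          f (z * Complex.exp (θ * Complex.I))) := by
      rw [hF]
      simp only [mul_pow, map_mul, map_pow, mul_comm z]
      ring
    simp_rw [h3]
    rw [intervalIntegral.integral_const_mul, h, Complex.ofReal_pow, ← Complex.conj_mul']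
    ring
  have hprod : Integrable (Function.uncurry fun (θ : ℝ) (z : ℂ) =>
      F (Complex.exp (θ * Complex.I) * z))
      ((volume.restrict (Set.uIoc 0 (2 * Real.pi))).prod μ) := by
    rw [integrable_prod_iff (by fun_prop)]
    refine ⟨Filter.Eventually.of_forall fun θ => (hrot θ).integrable_comp_of_integrable hFi, ?_⟩
    have h (θ : ℝ) : ∫ z, ‖F (Complex.exp (θ * Complex.I) * z)‖ ∂μ = ∫ z, ‖F z‖ ∂μ :=
      (hrot θ).integral_comp (hemb θ) fun z => ‖F z‖
    simp only [Function.uncurry_apply_pair, h]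
    exact integrable_const _
  have hswap := intervalIntegral_integral_swap hprod
  simp only [hint, hinner] at hswap
  rw [intervalIntegral.integral_const, integral_const_mul, integral_const_mul,
    integral_complex_ofReal, sub_zero] at hswap
  rw [norm_sq_eq, inner_def]
  refine mul_left_cancel₀ (Complex.ofReal_ne_zero.mpr Real.two_pi_pos.ne') ?_
  rw [← Complex.real_smul]
  simpa [hF, μ, monomial_apply] using hswap

theorem inner_monomial_monomial {m n : ℕ} (h : m ≠ n) :
    inner ℂ (monomial α m) (monomial α n) = 0 := by
  rw [inner_monomial]
  have : coeff (monomial α n) m = 0 := by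
    exact (coeff_pow n m).trans (if_neg h)
  rw [this, zero_mul]

/-! ### Norm convergence of the Taylor polynomials -/

/-- The Taylor polynomial of degree less than `N` at the origin, as an element of the Fock space. -/
noncomputable def taylorSum (f : Fock α) (N : ℕ) : Fock α :=
  ∑ n ∈ Finset.range N, coeff f n • monomial α n

theorem tendsto_taylorSum_apply (f : Fock α) (z : ℂ) :
    Filter.Tendsto (fun N => taylorSum f N z) Filter.atTop (nhds (f z)) := by
  simp only [taylorSum, sum_apply, smul_apply, monomial_apply]
  exact (hasSum_coeff f.differentiable z).tendsto_sum_nat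

/-- The Taylor polynomial is the orthogonal projection onto the polynomials of degree less than
`N`, so it is orthogonal to the remainder. -/
theorem inner_taylorSum_sub (f : Fock α) (N : ℕ) :
    inner ℂ (taylorSum f N) (f - taylorSum f N) = 0 := by
  nth_rewrite 1 [taylorSum]
  rw [sum_inner]
  refine Finset.sum_eq_zero fun m hm => ?_
  have h : inner ℂ (monomial α m) (taylorSum f N) = inner ℂ (monomial α m) f := by
    rw [taylorSum, inner_sum, Finset.sum_eq_single_of_mem m hm, inner_smul_right, inner_monomial f,
      inner_self_eq_norm_sq_to_K]
    · simp
    · intro n _ hn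
      rw [inner_smul_right, inner_monomial_monomial hn.symm, mul_zero]
  rw [inner_smul_left, inner_sub_right, h, sub_self, mul_zero]

theorem norm_sub_taylorSum_sq (f : Fock α) (N : ℕ) :
    ‖f - taylorSum f N‖ ^ 2 = ‖f‖ ^ 2 - ‖taylorSum f N‖ ^ 2 := by
  have h := norm_add_sq_eq_norm_sq_add_norm_sq_of_inner_eq_zero (𝕜 := ℂ) _ _
    (inner_taylorSum_sub f N)
  rw [add_sub_cancel] at h
  linarith

/-- Orthogonality bounds the norms of the Taylor polynomials by `‖f‖`, and Fatou's lemma bounds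
their lower limit from below by `‖f‖`. -/
theorem tendsto_norm_taylorSum (f : Fock α) :
    Filter.Tendsto (fun N => ‖taylorSum f N‖) Filter.atTop (nhds ‖f‖) := by
  have hle (N : ℕ) : ‖taylorSum f N‖ ≤ ‖f‖ := by
    have := norm_sub_taylorSum_sq f N
    exact le_of_sq_le_sq (by nlinarith [sq_nonneg ‖f - taylorSum f N‖]) (norm_nonneg f)
  have hfatou := Lp.eLpNorm_lim_le_liminf_eLpNorm (p := 2)
    (fun N => (taylorSum f N).memLp.1) (f : ℂ → ℂ)
    (Filter.Eventually.of_forall (tendsto_taylorSum_apply f))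
  simp only [eLpNorm_eq] at hfatou
  have h : Filter.Tendsto (fun N => ENNReal.ofReal ‖taylorSum f N‖) Filter.atTop
      (nhds (ENNReal.ofReal ‖f‖)) :=
    tendsto_of_le_liminf_of_limsup_le hfatou <|
      Filter.limsup_le_of_le (by isBoundedDefault)
        (Filter.Eventually.of_forall fun N => ENNReal.ofReal_le_ofReal (hle N))
  simpa [Function.comp_def] using (ENNReal.tendsto_toReal ENNReal.ofReal_ne_top).comp h

theorem tendsto_taylorSum (f : Fock α) :
    Filter.Tendsto (taylorSum f) Filter.atTop (nhds f) := by
  rw [tendsto_iff_norm_sub_tendsto_zero]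
  have h := ((tendsto_norm_taylorSum f).pow 2).const_sub (‖f‖ ^ 2)
  rw [sub_self] at h
  have h2 := h.sqrt
  rw [Real.sqrt_zero] at h2
  refine h2.congr fun N => ?_
  rw [← norm_sub_taylorSum_sq, Real.sqrt_sq (norm_nonneg _), norm_sub_rev]

theorem clm_eq_zero_of_monomial {X : Fock α →L[ℂ] Fock α} (h : ∀ n, X (monomial α n) = 0) :
    X = 0 := by
  ext1 f
  have h1 := (X.continuous.tendsto f).comp (tendsto_taylorSum f)
  have h2 (N : ℕ) : X (taylorSum f N) = 0 := by
    simp [taylorSum, h]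
  simp only [Function.comp_def, h2] at h1
  exact tendsto_nhds_unique h1 tendsto_const_nhds

/-! ### Powers centred at the fixed point -/

/-- The function `z ↦ (z - p) ^ n` as an element of the Fock space, given by its binomial
expansion. -/
noncomputable def shiftedMonomial (α : ℝ) [Fact (0 < α)] (p : ℂ) (n : ℕ) : Fock α :=
  ∑ m ∈ Finset.range (n + 1), ((-p) ^ (n - m) * n.choose m) • monomial α m

theorem shiftedMonomial_apply (p : ℂ) (n : ℕ) (z : ℂ) :
    shiftedMonomial α p n z = (z - p) ^ n := by
  rw [shiftedMonomial, sum_apply, sub_eq_add_neg, add_pow]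
  refine Finset.sum_congr rfl fun m _ => ?_
  rw [smul_apply, monomial_apply]
  ring

theorem shiftedMonomial_ne_zero (p : ℂ) (n : ℕ) : shiftedMonomial α p n ≠ 0 := by
  intro h
  have h1 : shiftedMonomial α p n (p + 1) = 0 := by rw [h]; rfl
  simp [shiftedMonomial_apply] at h1

theorem monomial_eq_sum_shiftedMonomial (p : ℂ) (n : ℕ) :
    monomial α n =
      ∑ m ∈ Finset.range (n + 1), (p ^ (n - m) * n.choose m) • shiftedMonomial α p m := by
  refine ext fun z => ?_
  rw [sum_apply, monomial_apply]
  conv_lhs => rw [← sub_add_cancel z p, add_pow]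
  refine Finset.sum_congr rfl fun m _ => ?_
  rw [smul_apply, shiftedMonomial_apply]
  ring

theorem exists_shiftedMonomial_ne_zero {X : Fock α →L[ℂ] Fock α} (hX : X ≠ 0) (p : ℂ) :
    ∃ n, X (shiftedMonomial α p n) ≠ 0 := by
  by_contra! h
  refine hX (clm_eq_zero_of_monomial fun n => ?_)
  rw [monomial_eq_sum_shiftedMonomial p n]
  simp [h]

/-- Only nontrivial translations lack a fixed point, and the hypothesis rules them out. -/
theorem exists_fixed_point {w b : ℂ} (hb : ‖w‖ = 1 → b = 0) : ∃ p, w * p + b = p := by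
  by_cases h : w = 1
  · exact ⟨0, by simp [hb (by simp [h])]⟩
  · have h1 : 1 - w ≠ 0 := sub_ne_zero.mpr (Ne.symm h)
    refine ⟨b / (1 - w), ?_⟩
    field_simp
    ring

theorem comp_shiftedMonomial {C : Fock α →L[ℂ] Fock α} {w b p : ℂ}
    (hC : IsCompositionOperator (fun z => w * z + b) C) (hp : w * p + b = p) (n : ℕ) :
    C (shiftedMonomial α p n) = w ^ n • shiftedMonomial α p n := by
  refine ext fun z => ?_
  rw [hC, smul_apply, shiftedMonomial_apply, shiftedMonomial_apply, ← mul_pow]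
  congr 1
  linear_combination hp

/-! ### Eigenvalues and the extended spectrum -/

/-- Comparison of a nonzero Taylor coefficient at the fixed point `p` determines the eigenvalue. -/
theorem eigenvalue_eq_pow {C : Fock α →L[ℂ] Fock α} {w b p : ℂ}
    (hC : IsCompositionOperator (fun z => w * z + b) C) (hp : w * p + b = p)
    {f : Fock α} (hf : f ≠ 0) {μ : ℂ} (h : C f = μ • f) : ∃ k : ℕ, μ = w ^ k := by
  set g : ℂ → ℂ := fun z => f (z + p) with hg
  have hgd : Differentiable ℂ g := f.differentiable.comp (by fun_prop)
  obtain ⟨z, hz⟩ : ∃ z, f z ≠ 0 := by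
    by_contra! h0
    exact hf (ext h0)
  obtain ⟨k, hk⟩ := exists_coeff_ne_zero hgd (z := z - p) (by simpa [hg] using hz)
  have h1 : (fun z => g (w * z)) = fun z => μ * g z := by
    funext z
    have h2 := hC f (z + p)
    rw [h, smul_apply] at h2
    rw [hg, h2]
    exact congrArg f.1 (by linear_combination -hp)
  have h3 := coeff_comp_mul hgd w k
  rw [h1, coeff_const_mul] at h3
  exact ⟨k, mul_right_cancel₀ hk h3⟩

/-- A bounded functional proportional to `f ↦ f^(j)(p)`. The preliminary contraction
`f ↦ f (z / 2 + p)` moves `p` to the origin by a bounded operator, after which the derivative is a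
multiple of the inner product with `z ^ j`. -/
theorem exists_coeff_functional (p : ℂ) (j : ℕ) :
    ∃ ℓ : Fock α →L[ℂ] ℂ, ∃ c : ℂ, c ≠ 0 ∧ ∀ f, ℓ f = c * coeff (fun z => f (z + p)) j := by
  have hhalf : ‖(1 / 2 : ℂ)‖ < 1 := by norm_num
  obtain ⟨D, hD⟩ := exists_isCompositionOperator (α := α) (1 / 2) p (by norm_num) hhalf.le
    (fun h => absurd h hhalf.ne)
  refine ⟨innerSL ℂ (monomial α j) ∘L D, (1 / 2) ^ j * (‖monomial α j‖ ^ 2 : ℝ), ?_, fun f => ?_⟩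
  · have := norm_ne_zero_iff.mpr (monomial_ne_zero (α := α) j)
    refine mul_ne_zero (pow_ne_zero j (by norm_num)) ?_
    exact_mod_cast pow_ne_zero 2 this
  · have h1 : (D f : ℂ → ℂ) = fun z => f (1 / 2 * z + p) := funext (hD f)
    have h2 := coeff_comp_mul (f := fun z => f (z + p)) (f.differentiable.comp (by fun_prop))
      (1 / 2) j
    rw [ContinuousLinearMap.comp_apply, innerSL_apply_apply, inner_monomial, h1, h2]
    ring

/-- With `w ^ n = w ^ k / w ^ j`, the rank-one operator `f ↦ ℓ f • (z - p) ^ k` intertwines, where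
`ℓ` is a multiple of the `j`-th derivative at `p`: `C` scales the vector by `w ^ k`, and its
transpose scales `ℓ` by `w ^ j`. -/
theorem zpow_mem_extendedSpectrum {C : Fock α →L[ℂ] Fock α} {w b p : ℂ} (hw0 : w ≠ 0)
    (hC : IsCompositionOperator (fun z => w * z + b) C) (hp : w * p + b = p) (n : ℤ) :
    w ^ n ∈ extendedSpectrum C := by
  obtain ⟨j, k, rfl⟩ : ∃ j k : ℕ, n = k - j := ⟨(-n).toNat, n.toNat, by omega⟩
  obtain ⟨ℓ, c, hc, hℓ⟩ := exists_coeff_functional (α := α) p j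
  have hℓC (f : Fock α) : ℓ (C f) = w ^ j * ℓ f := by
    have h1 : (fun z => C f (z + p)) = fun z => f (w * z + p) := by
      funext z
      rw [hC]
      exact congrArg f.1 (by linear_combination hp)
    have h2 := coeff_comp_mul (f := fun z => f (z + p)) (f.differentiable.comp (by fun_prop)) w j
    rw [hℓ, hℓ, h1, h2]
    ring
  have hℓ0 : ℓ (shiftedMonomial α p j) ≠ 0 := by
    rw [hℓ]
    simp only [shiftedMonomial_apply, add_sub_cancel_right, coeff_pow, if_true, mul_one]
    exact hc
  refine ⟨ℓ.smulRight (shiftedMonomial α p k), fun h0 => ?_, ?_⟩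
  · have h1 := DFunLike.congr_fun h0 (shiftedMonomial α p j)
    rw [ContinuousLinearMap.smulRight_apply] at h1
    exact smul_ne_zero hℓ0 (shiftedMonomial_ne_zero p k) h1
  · ext1 f
    simp only [ContinuousLinearMap.comp_apply, ContinuousLinearMap.smulRight_apply,
      _root_.smul_apply, map_smul, comp_shiftedMonomial hC hp, hℓC, smul_smul]
    congr 1
    rw [zpow_sub₀ hw0, zpow_natCast, zpow_natCast]
    field_simp

/-- An intertwining operator sends eigenvectors of `C` to eigenvectors, and it cannot vanish on
all the `(z - p) ^ n`, whose span is dense. -/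
theorem exists_zpow_of_mem_extendedSpectrum {C : Fock α →L[ℂ] Fock α} {w b p : ℂ} (hw0 : w ≠ 0)
    (hC : IsCompositionOperator (fun z => w * z + b) C) (hp : w * p + b = p) {μ : ℂ}
    (hμ : μ ∈ extendedSpectrum C) : ∃ n : ℤ, μ = w ^ n := by
  obtain ⟨X, hX, hCX⟩ := hμ
  obtain ⟨n, hn⟩ := exists_shiftedMonomial_ne_zero hX p
  have h := DFunLike.congr_fun hCX (shiftedMonomial α p n)
  simp only [ContinuousLinearMap.comp_apply, _root_.smul_apply,
    comp_shiftedMonomial hC hp, map_smul, smul_smul] at h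
  obtain ⟨k, hk⟩ := eigenvalue_eq_pow hC hp hn h
  refine ⟨k - n, ?_⟩
  rw [zpow_sub₀ hw0, zpow_natCast, zpow_natCast, ← hk]
  field_simp

end Fock

theorem theorem3p4 (α : ℝ) [Fact (0 < α)] (w b : ℂ) (hw0 : w ≠ 0) (hw : ‖w‖ ≤ 1)
    (hb : ‖w‖ = 1 → b = 0) :
    (∃ C : Fock α →L[ℂ] Fock α, IsCompositionOperator (fun z => w * z + b) C) ∧
      ∀ C : Fock α →L[ℂ] Fock α, IsCompositionOperator (fun z => w * z + b) C →
        extendedSpectrum C = {μ : ℂ | ∃ n : ℤ, μ = w ^ n} := by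
  refine ⟨Fock.exists_isCompositionOperator w b hw0 hw hb, fun C hC => ?_⟩
  obtain ⟨p, hp⟩ := Fock.exists_fixed_point hb
  refine Set.Subset.antisymm
    (fun μ hμ => Fock.exists_zpow_of_mem_extendedSpectrum hw0 hC hp hμ) ?_
  rintro _ ⟨n, rfl⟩
  exact Fock.zpow_mem_extendedSpectrum hw0 hC hp n
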